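/- Let $n\ge 1$ and let $\mathcal G$ be a simple weighted directed graph on the vertices $v_1,\dots,v_n$: $\mathcal G$ has no self-loops, and its adjacency matrix $A=[a_{ij}]\in\mathbb R^{n\times n}$ satisfies $a_{ij}>0$ if there is an edge $(v_j,v_i)$ from the parent $v_j$ to the child $v_i$, and $a_{ij}=0$ otherwise. Let $\mathcal H=\{h+\varepsilon h' : h,h'\in\mathbb H\}$, $\varepsilon^2=0\neq\varepsilon$, be the dual quaternions with the Euclidean topology of $\mathbb R^8$, and let $\mathcal H_p=\{h+\varepsilon h'\in\mathcal H:\operatorname{Re}h=\operatorname{Re}h'=0\}\cong\mathbb R^6$ be the real vector space of pure dual quaternions. Consider $n$ agents with outputs $y_i:[0,\infty)\to\mathcal H_p$ and dynamics $\dot y_i=u_i$ under the protocol $$u_i=-\sum_{j=1}^n a_{ij}(y_i-y_j),\qquad i=1,\dots,n .$$ Then the system asymptotically achieves output consensus, that is, $$\lim_{t\to\infty}\bigl(y_i(t)-y_j(t)\bigr)=0\qquad\text{for all } i,j=1,\dots,n$$ for every solution $(y_1,\dots,y_n)$ on $[0,\infty)$ (equivalently, for all initial outputs $y_i(0)\in\mathcal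 H_p$), if and only if $\mathcal G$ has a directed spanning tree. A directed tree is a directed graph with exactly one node without parents, called the root, in which every other node has exactly one parent and there is a directed path from the root to every other node; a directed spanning tree of $\mathcal G$ is a directed tree containing all the nodes of $\mathcal G$, obtained from $\mathcal G$ by removing some (possibly none) of its edges, with a unique directed path from the root to any other node. -/

import Mathlib

open Filter Topology
open scoped Quaternion

/-- The dual quaternions `h + ε h'` with `h, h'` real quaternions and `ε² = 0`, where `fst` is `h`
and `snd` is `h'`. The topology is the product topology, i.e. the Euclidean one of `ℝ⁸`. -/
abbrev DualQuaternion : Type := DualNumber ℍ[ℝ]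

/-- The real part `Re (h + ε h') = Re h + ε Re h'`, a dual number. -/
noncomputable def DualQuaternion.real : DualQuaternion →ₗ[ℝ] DualNumber ℝ where
  toFun q := (q.fst.re, q.snd.re)
  map_add' _ _ := rfl
  map_smul' _ _ := rfl

/-- The set of pure dual quaternions, i.e. those with zero real part, as a real
vector space with the topology induced by the dual quaternions. -/
noncomputable def PureDualQuaternion : Submodule ℝ DualQuaternion := LinearMap.ker DualQuaternion.real

/-- `p` lists the successive vertices of a directed path from `u` to `v`. -/
def IsDirectedPath {V : Type*} (T : Digraph V) (u v : V) (p : List V) : Prop :=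
  p.IsChain T.Adj ∧ p.head? = some u ∧ p.getLast? = some v

/-- A directed tree with root `r`: the root is the only node without parents, all other nodes have
exactly one parent, and there is a directed path from the root to every other node. Here
`T.Adj u v` is the edge from the parent `u` to the child `v`. -/
structure IsDirectedTree {V : Type*} (T : Digraph V) (r : V) : Prop where
  root_no_parent : ∀ u, ¬ T.Adj u r
  unique_parent : ∀ v, v ≠ r → ∃! u, T.Adj u v
  exists_path : ∀ v, v ≠ r → ∃ p, IsDirectedPath T r v p

/-- The digraph has a directed spanning tree: a directed tree on all of its nodes obtained by
removing some of its edges, with a unique directed path from the root to any other node. -/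
def HasDirectedSpanningTree {V : Type*} (G : Digraph V) : Prop :=
  ∃ T : Digraph V, T ≤ G ∧ ∃ r : V, IsDirectedTree T r ∧
    ∀ v, v ≠ r → ∃! p, IsDirectedPath T r v p

/-- A simple weighted directed graph on the vertices `v₁, …, vₙ`: a directed graph without
self-loops and an adjacency matrix `A = [a i j]` with `a i j > 0` if there is an edge from `v j`
to `v i`, and `a i j = 0` otherwise. -/
structure WeightedDigraph (n : ℕ) extends Digraph (Fin n) where
  loopless : ∀ i, ¬ Adj i i
  A : Matrix (Fin n) (Fin n) ℝ
  pos_of_adj : ∀ i j, Adj j i → 0 < A i j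
  eq_zero_of_not_adj : ∀ i j, ¬ Adj j i → A i j = 0

/-- The outputs `y` follow the dynamics `ẏ i = u i` on `[0, ∞)`; the derivative at time `0` is
one-sided. -/
def IsSingleIntegrator {n : ℕ} (y u : Fin n → ℝ → PureDualQuaternion) : Prop :=
  ∀ i, ∀ t, 0 ≤ t → HasDerivWithinAt (y i) (u i t) (Set.Ici 0) t

/-- The inputs `u` are given by the protocol `u i = -∑ j, a i j (y i - y j)` on `[0, ∞)`. -/
def FollowsConsensusProtocol {n : ℕ} (G : WeightedDigraph n)
    (y u : Fin n → ℝ → PureDualQuaternion) : Prop :=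
  ∀ i, ∀ t, 0 ≤ t → u i t = -∑ j, G.A i j • (y i t - y j t)

/-- The outputs `y` asymptotically achieve output consensus. -/
def AchievesOutputConsensus {n : ℕ} (y : Fin n → ℝ → PureDualQuaternion) : Prop :=
  ∀ i j, Tendsto (fun t => y i t - y j t) atTop (𝓝 0)

/-! A directed spanning tree exists iff some node r reaches all others. Let M be `consensusMatrix
A`, minus the Laplacian. In real coordinates solutions are exp(tM) x(0), and exp(tM) is stochastic
for t ≥ 0. If r reaches every node, column r of exp(M) is positive, so each unit of time shrinks an
interval enclosing all agents by a fixed factor below 1 (`Matrix.exists_mulVec_mem_Icc`). Otherwise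
two nodes have no common ancestor. Their ancestor sets are disjoint, no edge enters them, and each
carries a left null vector of M. Hence ker M has dimension at least 2 and contains a nonconstant
equilibrium. -/

/-! ### Spanning trees and reachability -/

section DirectedTrees

variable {V : Type*} {T G : Digraph V} {r u v : V}

/-- Unique parents determine a path backwards from its end, so paths are taken apart at the last
vertex. -/
theorem isDirectedPath_concat {p : List V} {x : V} :
    IsDirectedPath T u v (p ++ [x]) ↔
      x = v ∧ (p = [] ∧ u = v ∨ ∃ w, IsDirectedPath T u w p ∧ T.Adj w v) := by
  unfold IsDirectedPath
  rcases p.eq_nil_or_concat with rfl | ⟨q, w, rfl⟩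
  · simp only [List.nil_append, List.isChain_singleton, List.head?_cons, List.getLast?_singleton,
      Option.some.injEq, true_and]
    simp
    grind
  · simp only [List.isChain_append, List.getLast?_append, List.head?_append]
    simp
    grind

theorem not_isDirectedPath_nil : ¬ IsDirectedPath T u v [] := by
  simp [IsDirectedPath]

theorem reflTransGen_adj_iff_exists_isDirectedPath :
    Relation.ReflTransGen T.Adj u v ↔ ∃ p, IsDirectedPath T u v p := by
  constructor
  · intro h
    induction h with
    | refl => exact ⟨[u], by simp [IsDirectedPath]⟩
    | tail _ hbc ih =>
      obtain ⟨p, hp⟩ := ih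
      exact ⟨p ++ [_], isDirectedPath_concat.2 ⟨rfl, .inr ⟨_, hp, hbc⟩⟩⟩
  · rintro ⟨p, hp⟩
    induction p using List.reverseRecOn generalizing v with
    | nil => exact (not_isDirectedPath_nil hp).elim
    | append_singleton p x ih =>
      obtain ⟨rfl, ⟨-, rfl⟩ | ⟨w, hw, hwv⟩⟩ := isDirectedPath_concat.1 hp
      · exact .refl
      · exact (ih hw).tail hwv

/-- In a digraph in which `r` has no parent and other nodes have at most one parent, paths from `r`
are determined by their end. -/
theorem IsDirectedPath.eq_of_unique_parent (hr : ∀ u, ¬ T.Adj u r)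
    (hT : ∀ u u' v, T.Adj u v → T.Adj u' v → u = u') {p q : List V}
    (hp : IsDirectedPath T r v p) (hq : IsDirectedPath T r v q) : p = q := by
  induction p using List.reverseRecOn generalizing v q with
  | nil => exact (not_isDirectedPath_nil hp).elim
  | append_singleton p x ih =>
    rcases q.eq_nil_or_concat' with rfl | ⟨q, y, rfl⟩
    · exact (not_isDirectedPath_nil hq).elim
    obtain ⟨rfl, ⟨rfl, rfl⟩ | ⟨w, hw, hwv⟩⟩ := isDirectedPath_concat.1 hp <;>
    obtain ⟨rfl, ⟨rfl, h⟩ | ⟨w', hw', hwv'⟩⟩ := isDirectedPath_concat.1 hq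
    · rfl
    · exact (hr _ hwv').elim
    · exact (hr w (h ▸ hwv)).elim
    · rw [ih hw (hT _ _ _ hwv hwv' ▸ hw')]

/-- If every node is reachable from `r`, then every other node has a parent that is nearer to `r`. -/
theorem exists_depth_of_forall_reflTransGen (h : ∀ v, Relation.ReflTransGen G.Adj r v) :
    ∃ d : V → ℕ, ∀ v, v ≠ r → ∃ u, G.Adj u v ∧ d u < d v := by
  -- The depth counts the vertices of a shortest path; deleting the last one gives a shorter path to
  -- a parent.
  refine ⟨fun v => sInf {k | ∃ p, IsDirectedPath G r v p ∧ p.length = k}, fun v hv => ?_⟩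
  obtain ⟨p₀, hp₀⟩ := reflTransGen_adj_iff_exists_isDirectedPath.1 (h v)
  obtain ⟨p, hp, hlen⟩ := Nat.sInf_mem
    (s := {k | ∃ p, IsDirectedPath G r v p ∧ p.length = k}) ⟨_, p₀, hp₀, rfl⟩
  rcases p.eq_nil_or_concat' with rfl | ⟨q, y, rfl⟩
  · exact (not_isDirectedPath_nil hp).elim
  obtain ⟨rfl, ⟨-, h'⟩ | ⟨w, hw, hwv⟩⟩ := isDirectedPath_concat.1 hp
  · exact (hv h'.symm).elim
  · refine ⟨w, hwv, lt_of_le_of_lt (Nat.sInf_le ⟨q, hw, rfl⟩) ?_⟩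
    simp [← hlen]

theorem hasDirectedSpanningTree_of_forall_reflTransGen
    (h : ∀ v, Relation.ReflTransGen G.Adj r v) : HasDirectedSpanningTree G := by
  obtain ⟨d, hd⟩ := exists_depth_of_forall_reflTransGen h
  choose! f hf hdf using hd
  -- Each non-root node keeps only the edge from one chosen parent of smaller depth.
  let T : Digraph V := ⟨fun u v => v ≠ r ∧ u = f v⟩
  have hr : ∀ u, ¬ T.Adj u r := fun u hu => hu.1 rfl
  have huniq : ∀ u u' v, T.Adj u v → T.Adj u' v → u = u' :=
    fun u u' v h h' => h.2.trans h'.2.symm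
  have hreach : ∀ k v, d v = k → Relation.ReflTransGen T.Adj r v := by
    intro k
    induction k using Nat.strong_induction_on with
    | _ k ih =>
      intro v hv
      by_cases hvr : v = r
      · rw [hvr]
      · exact (ih _ (hv ▸ hdf v hvr) _ rfl).tail ⟨hvr, rfl⟩
  have hpath : ∀ v, ∃ p, IsDirectedPath T r v p :=
    fun v => reflTransGen_adj_iff_exists_isDirectedPath.1 (hreach _ v rfl)
  refine ⟨T, fun u v huv => huv.2 ▸ hf v huv.1, r, ⟨hr, fun v hv => ?_, fun v _ => hpath v⟩, ?_⟩
  · exact ⟨f v, ⟨hv, rfl⟩, fun u hu => hu.2⟩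
  · intro v _
    obtain ⟨p, hp⟩ := hpath v
    exact ⟨p, hp, fun q hq => hq.eq_of_unique_parent hr huniq hp⟩

theorem hasDirectedSpanningTree_iff_exists_forall_reflTransGen :
    HasDirectedSpanningTree G ↔ ∃ r, ∀ v, Relation.ReflTransGen G.Adj r v := by
  constructor
  · rintro ⟨T, hTG, r, hT, -⟩
    refine ⟨r, fun v => ?_⟩
    by_cases hv : v = r
    · rw [hv]
    · exact Relation.ReflTransGen.mono (fun _ _ h => hTG h) _ _
        (reflTransGen_adj_iff_exists_isDirectedPath.2 (hT.exists_path v hv))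
  · rintro ⟨r, h⟩
    exact hasDirectedSpanningTree_of_forall_reflTransGen h

/-- A finite digraph in which no node reaches all others has two nodes without common ancestor. -/
theorem exists_no_common_ancestor [Finite V] [Nonempty V]
    (h : ¬ ∃ r, ∀ v, Relation.ReflTransGen G.Adj r v) :
    ∃ a b, ∀ w, Relation.ReflTransGen G.Adj w a → ¬ Relation.ReflTransGen G.Adj w b := by
  by_contra! hc
  -- If any two nodes had a common ancestor, reachability would be directed, and finiteness would
  -- give an ancestor of all nodes.
  have hdir : Directed (fun a b => Relation.ReflTransGen G.Adj b a) (id : V → V) := hc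
  have : IsTrans V (fun a b => Relation.ReflTransGen G.Adj b a) :=
    ⟨fun _ _ _ h₁ h₂ => h₂.trans h₁⟩
  exact h (hdir.finite_le id)

end DirectedTrees

/-! ### Null vectors of the Laplacian -/

section ConsensusMatrix

variable {V : Type*} [Fintype V] [DecidableEq V]

/-- The negative of the Laplacian of the weight matrix `A`. -/
def consensusMatrix (A : Matrix V V ℝ) : Matrix V V ℝ :=
  A - Matrix.diagonal fun i => ∑ j, A i j

theorem consensusMatrix_mulVec_apply (A : Matrix V V ℝ) (x : V → ℝ) (i : V) :
    (consensusMatrix A).mulVec x i = -∑ j, A i j * (x i - x j) := by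
  simp only [consensusMatrix, Matrix.sub_mulVec, Pi.sub_apply, Matrix.mulVec_diagonal, mul_sub,
    Finset.sum_sub_distrib, Finset.sum_mul]
  rw [Matrix.mulVec, dotProduct]
  ring

theorem consensusMatrix_apply_of_ne (A : Matrix V V ℝ) {i j : V} (h : i ≠ j) :
    consensusMatrix A i j = A i j := by
  simp [consensusMatrix, h]

/-- A nonempty set of nodes without incoming edges carries a left null vector. -/
theorem exists_vecMul_consensusMatrix_eq_zero {A : Matrix V V ℝ} {S : Set V} {a : V} (ha : a ∈ S)
    (hS : ∀ i ∈ S, ∀ j ∉ S, A i j = 0) :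
    ∃ w : V → ℝ, w ≠ 0 ∧ (∀ i ∉ S, w i = 0) ∧ Matrix.vecMul w (consensusMatrix A) = 0 := by
  classical
  have hM : ∀ i ∈ S, ∀ j ∉ S, consensusMatrix A i j = 0 := fun i hi j hj => by
    rw [consensusMatrix_apply_of_ne A (by rintro rfl; exact hj hi), hS i hi j hj]
  have hext : ∀ f : V → ℝ, (∀ j ∉ S, f j = 0) → ∑ j : S, f j = ∑ j, f j := fun f hf => by
    rw [← Fintype.sum_subtype_add_sum_subtype (· ∈ S) f,
      Finset.sum_eq_zero fun (j : {j // j ∉ S}) _ => hf j j.2, add_zero]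
  -- The rows of S vanish off S, so this block inherits zero row sums and is singular; its left null
  -- vector is extended by zero.
  let N : Matrix S S ℝ := (consensusMatrix A).submatrix (↑) (↑)
  have hdet : N.det = 0 := by
    refine Matrix.exists_mulVec_eq_zero_iff.1 ⟨1, ?_, ?_⟩
    · exact fun h => one_ne_zero (congr_fun h ⟨a, ha⟩)
    · ext i
      have h := consensusMatrix_mulVec_apply A 1 i
      simp only [Pi.one_apply, sub_self, mul_zero, Finset.sum_const_zero, neg_zero] at h
      rw [Matrix.mulVec, dotProduct] at h ⊢
      exact (hext (fun j => consensusMatrix A i j * (1 : V → ℝ) j)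
        (fun j hj => by simp [hM i i.2 j hj])).trans h
  obtain ⟨w, hw, hwN⟩ := Matrix.exists_vecMul_eq_zero_iff.2 hdet
  refine ⟨fun i => if h : i ∈ S then w ⟨i, h⟩ else 0, fun h => hw ?_, fun i hi => by simp [hi], ?_⟩
  · ext i
    simpa using congr_fun h i
  · ext j
    rw [Matrix.vecMul, dotProduct, ← hext _ (fun i hi => by simp [hi])]
    by_cases hj : j ∈ S
    · simpa [N, Matrix.vecMul, dotProduct] using congr_fun hwN ⟨j, hj⟩
    · simp [hM _ (Subtype.prop _) j hj]

/-- Two disjoint nonempty sets of nodes without incoming edges yield a nonconstant equilibrium. -/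
theorem exists_nonconstant_mulVec_consensusMatrix_eq_zero {A : Matrix V V ℝ} {S T : Set V}
    {a b : V} (ha : a ∈ S) (hb : b ∈ T) (hST : Disjoint S T)
    (hS : ∀ i ∈ S, ∀ j ∉ S, A i j = 0) (hT : ∀ i ∈ T, ∀ j ∉ T, A i j = 0) :
    ∃ x : V → ℝ, (∃ i j, x i ≠ x j) ∧ (consensusMatrix A).mulVec x = 0 := by
  obtain ⟨w₁, hw₁, hS₁, h₁⟩ := exists_vecMul_consensusMatrix_eq_zero ha hS
  obtain ⟨w₂, hw₂, hT₂, h₂⟩ := exists_vecMul_consensusMatrix_eq_zero hb hT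
  set M := consensusMatrix A
  have hind : LinearIndependent ℝ ![w₁, w₂] := by
    rw [LinearIndependent.pair_iff]
    intro s t hst
    constructor
    · obtain ⟨i, hi⟩ := Function.ne_iff.1 hw₁
      have hiS : i ∈ S := by_contra fun h => hi (hS₁ i h)
      have := congr_fun hst i
      simp only [Pi.add_apply, Pi.smul_apply, hT₂ i (Set.disjoint_left.1 hST hiS)] at this
      simpa using Or.resolve_right (by simpa using this) hi
    · obtain ⟨i, hi⟩ := Function.ne_iff.1 hw₂
      have hiT : i ∈ T := by_contra fun h => hi (hT₂ i h)
      have := congr_fun hst i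
      simp only [Pi.add_apply, Pi.smul_apply, hS₁ i (Set.disjoint_right.1 hST hiT)] at this
      simpa using Or.resolve_right (by simpa using this) hi
  -- Otherwise the kernel of M is at most a line, while that of its transpose contains w₁ and w₂;
  -- the two ranks agree.
  by_contra! hc
  have hker : LinearMap.ker M.mulVecLin ≤ Submodule.span ℝ {(1 : V → ℝ)} := by
    intro x hx
    refine Submodule.mem_span_singleton.2 ⟨x a, ?_⟩
    ext i
    have hx' : M.mulVec x = 0 := by simpa using hx
    have : x a = x i := by
      by_contra h
      exact hc x ⟨a, i, h⟩ hx'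
    simpa using this
  have h1 : Module.finrank ℝ (LinearMap.ker M.mulVecLin) ≤ 1 :=
    (Submodule.finrank_mono hker).trans (by simpa using finrank_span_le_card ({1} : Set (V → ℝ)))
  have h2 : 2 ≤ Module.finrank ℝ (LinearMap.ker M.transpose.mulVecLin) := by
    have hspan : Submodule.span ℝ (Set.range ![w₁, w₂]) ≤ LinearMap.ker M.transpose.mulVecLin := by
      rw [Submodule.span_le]
      rintro _ ⟨k, rfl⟩
      fin_cases k <;> simp [h₁, h₂]
    have := Submodule.finrank_mono hspan
    rwa [finrank_span_eq_card hind, Fintype.card_fin] at this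
  have e1 := M.mulVecLin.finrank_range_add_finrank_ker
  have e2 := M.transpose.mulVecLin.finrank_range_add_finrank_ker
  have e3 := M.rank_transpose
  simp only [Matrix.rank] at e3
  omega

end ConsensusMatrix

/-! ### Positivity and stochasticity of the flow -/

section MatrixExponential

variable {V : Type*} [Fintype V] [DecidableEq V]

attribute [local instance] Matrix.linftyOpNormedRing Matrix.linftyOpNormedAlgebra

theorem Matrix.hasSum_exp_apply (B : Matrix V V ℝ) (i j : V) :
    HasSum (fun k : ℕ => ((k.factorial : ℝ)⁻¹) * (B ^ k) i j) (NormedSpace.exp B i j) := by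
  have h := NormedSpace.exp_series_hasSum_exp' (𝕂 := ℝ) B
  exact Pi.hasSum.1 (Pi.hasSum.1 h i) j

theorem Matrix.exp_apply_nonneg {B : Matrix V V ℝ} (hB : ∀ i j, 0 ≤ B i j) (i j : V) :
    0 ≤ NormedSpace.exp B i j :=
  (B.hasSum_exp_apply i j).nonneg fun _ => mul_nonneg (by positivity) (Matrix.pow_apply_nonneg hB _ i j)

theorem Matrix.exp_apply_pos {B : Matrix V V ℝ} (hB : ∀ i j, 0 ≤ B i j) {i j : V} {k : ℕ}
    (h : 0 < (B ^ k) i j) : 0 < NormedSpace.exp B i j :=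
  (mul_pos (by positivity) h).trans_le <| le_hasSum (B.hasSum_exp_apply i j) k
    fun _ _ => mul_nonneg (by positivity) (Matrix.pow_apply_nonneg hB _ i j)

/-- Entry (i, r) of B ^ k sums the weights of walks of length k from r to i. -/
theorem Matrix.exists_pow_apply_pos {B : Matrix V V ℝ} (hB : ∀ i j, 0 ≤ B i j) {r i : V}
    (h : Relation.ReflTransGen (fun j i => 0 < B i j) r i) : ∃ k : ℕ, 0 < (B ^ k) i r := by
  induction h with
  | refl => exact ⟨0, by simp⟩
  | @tail j i _ hji ih =>
    obtain ⟨k, hk⟩ := ih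
    refine ⟨k + 1, ?_⟩
    rw [pow_succ', Matrix.mul_apply]
    exact Finset.sum_pos' (fun l _ => mul_nonneg (hB i l) (Matrix.pow_apply_nonneg hB _ l r))
      ⟨j, Finset.mem_univ _, mul_pos hji hk⟩

theorem Matrix.exp_add_smul_one (B : Matrix V V ℝ) (c : ℝ) :
    NormedSpace.exp (B + c • (1 : Matrix V V ℝ)) = Real.exp c • NormedSpace.exp B := by
  have h : NormedSpace.exp (c • (1 : Matrix V V ℝ)) = Real.exp c • (1 : Matrix V V ℝ) := by
    rw [Matrix.smul_one_eq_diagonal, Matrix.exp_diagonal, Matrix.smul_one_eq_diagonal]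
    congr 1
    ext i
    rw [Pi.coe_exp, Real.exp_eq_exp_ℝ]
  rw [Matrix.exp_add_of_commute _ _ ((Commute.one_right B).smul_right c), h, mul_smul_comm,
    mul_one]

theorem Matrix.eq_exp_mulVec_of_hasDerivWithinAt (M : Matrix V V ℝ) {x : ℝ → V → ℝ}
    (hx : ∀ t, 0 ≤ t → HasDerivWithinAt x (M.mulVec (x t)) (Set.Ici 0) t) {s t : ℝ}
    (hs : 0 ≤ s) (hst : s ≤ t) : x t = (NormedSpace.exp ((t - s) • M)).mulVec (x s) := by
  let ev : Matrix V V ℝ →L[ℝ] (V → ℝ) :=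
    LinearMap.toContinuousLinearMap (LinearMap.flip (Matrix.mulVecBilin ℝ ℝ) (x s))
  let F : (V → ℝ) →L[ℝ] (V → ℝ) := LinearMap.toContinuousLinearMap M.mulVecLin
  have hexp : ∀ τ, HasDerivAt (fun τ => (NormedSpace.exp ((τ - s) • M)).mulVec (x s))
      (M.mulVec ((NormedSpace.exp ((τ - s) • M)).mulVec (x s))) τ := fun τ => by
    have h := (hasDerivAt_exp_smul_const' (𝕂 := ℝ) M (τ - s)).comp_sub_const τ s
    have h' := ev.hasFDerivAt.comp_hasDerivAt τ h
    rw [Matrix.mulVec_mulVec]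
    exact h'
  refine ODE_solution_unique (f := x)
    (g := fun τ => (NormedSpace.exp ((τ - s) • M)).mulVec (x s)) (v := fun _ y => M.mulVec y) (K := ‖F‖₊) (a := s) (b := t)
    (fun _ => F.lipschitz) ?_ ?_ ?_ ?_ ?_ ⟨hst, le_rfl⟩
  · exact fun τ hτ => (hx τ (hs.trans hτ.1)).continuousWithinAt.mono
      fun σ hσ => hs.trans hσ.1
  · exact fun τ hτ => (hx τ (hs.trans hτ.1)).mono (Set.Ici_subset_Ici.2 (hs.trans hτ.1))
  · exact fun τ _ => (hexp τ).continuousAt.continuousWithinAt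
  · exact fun τ _ => (hexp τ).hasDerivWithinAt
  · simp

variable {A : Matrix V V ℝ}

/-- Constant states are equilibria, so uniqueness of solutions gives row sums 1. -/
theorem exp_smul_consensusMatrix_mulVec_one (A : Matrix V V ℝ) {t : ℝ} (ht : 0 ≤ t) :
    (NormedSpace.exp (t • consensusMatrix A)).mulVec 1 = 1 := by
  have h := Matrix.eq_exp_mulVec_of_hasDerivWithinAt (consensusMatrix A) (x := fun _ => 1)
    (fun τ _ => ?_) le_rfl ht
  · simpa using h.symm
  · have : (consensusMatrix A).mulVec 1 = 0 := by
      ext i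
      simp [consensusMatrix_mulVec_apply]
    rw [this]
    exact hasDerivWithinAt_const _ _ _

/-- A shift making the consensus matrix entrywise nonnegative. -/
theorem exists_consensusMatrix_add_smul_one_nonneg (hA : ∀ i j, 0 ≤ A i j) :
    ∃ c : ℝ, ∀ i j, 0 ≤ (consensusMatrix A + c • (1 : Matrix V V ℝ)) i j := by
  -- The total weight dominates each row sum subtracted on the diagonal.
  refine ⟨∑ i, ∑ j, A i j, fun i j => ?_⟩
  have h : ∑ j, A i j ≤ ∑ i, ∑ j, A i j := Finset.single_le_sum (f := fun i => ∑ j, A i j)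
    (fun i _ => Finset.sum_nonneg fun j _ => hA i j) (Finset.mem_univ i)
  by_cases hij : i = j
  · subst hij
    have := hA i i
    simp only [consensusMatrix, Matrix.add_apply, Matrix.sub_apply, Matrix.diagonal_apply_eq,
      Matrix.smul_apply, Matrix.one_apply_eq, smul_eq_mul]
    linarith
  · simpa [consensusMatrix_apply_of_ne A hij, hij] using hA i j

/-- Shifting by a multiple of the identity only scales the exponential by a positive factor. -/
theorem exp_smul_consensusMatrix_apply_nonneg (hA : ∀ i j, 0 ≤ A i j) {t : ℝ} (ht : 0 ≤ t)
    (i j : V) : 0 ≤ NormedSpace.exp (t • consensusMatrix A) i j := by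
  obtain ⟨c, hc⟩ := exists_consensusMatrix_add_smul_one_nonneg hA
  have h : t • consensusMatrix A =
      t • (consensusMatrix A + c • (1 : Matrix V V ℝ)) + (-(t * c)) • (1 : Matrix V V ℝ) := by
    module
  rw [h, Matrix.exp_add_smul_one]
  exact mul_nonneg (Real.exp_pos _).le
    (Matrix.exp_apply_nonneg (fun i j => mul_nonneg ht (hc i j)) i j)

theorem exp_consensusMatrix_apply_pos (hA : ∀ i j, 0 ≤ A i j) {r i : V}
    (h : Relation.ReflTransGen (fun j i => 0 < A i j ∧ i ≠ j) r i) :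
    0 < NormedSpace.exp (consensusMatrix A) i r := by
  obtain ⟨c, hc⟩ := exists_consensusMatrix_add_smul_one_nonneg hA
  have h' : consensusMatrix A =
      (consensusMatrix A + c • (1 : Matrix V V ℝ)) + (-c) • (1 : Matrix V V ℝ) := by
    module
  obtain ⟨k, hk⟩ := Matrix.exists_pow_apply_pos hc (r := r) (i := i) <|
    Relation.ReflTransGen.mono (fun j i hji => by
      simpa [consensusMatrix_apply_of_ne A hji.2, hji.2] using hji.1) _ _ h
  rw [h', Matrix.exp_add_smul_one]
  exact mul_pos (Real.exp_pos _) (Matrix.exp_apply_pos hc hk)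

end MatrixExponential

/-! ### Contraction and real-valued consensus -/

section Contraction

variable {V : Type*} [Fintype V]

theorem Matrix.mulVec_mem_Icc {P : Matrix V V ℝ} (hP : ∀ i j, 0 ≤ P i j)
    (h1 : P.mulVec 1 = 1) {x : V → ℝ} {a b : ℝ} (hx : ∀ i, x i ∈ Set.Icc a b) (i : V) :
    P.mulVec x i ∈ Set.Icc a b := by
  have hsum : ∑ j, P i j = 1 := by simpa [Matrix.mulVec, dotProduct] using congr_fun h1 i
  rw [Matrix.mulVec, dotProduct]
  constructor
  · calc a = ∑ j, P i j * a := by rw [← Finset.sum_mul, hsum, one_mul]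
      _ ≤ _ := Finset.sum_le_sum fun j _ => mul_le_mul_of_nonneg_left (hx j).1 (hP i j)
  · calc _ ≤ ∑ j, P i j * b :=
          Finset.sum_le_sum fun j _ => mul_le_mul_of_nonneg_left (hx j).2 (hP i j)
      _ = b := by rw [← Finset.sum_mul, hsum, one_mul]

/-- A stochastic matrix with a column bounded below by `δ` shrinks enclosing intervals
by the factor `1 - δ`. -/
theorem Matrix.exists_mulVec_mem_Icc {P : Matrix V V ℝ} (hP : ∀ i j, 0 ≤ P i j)
    (h1 : P.mulVec 1 = 1) {r : V} {δ : ℝ} (hδ : ∀ i, δ ≤ P i r) {x : V → ℝ} {a b : ℝ}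
    (hx : ∀ i, x i ∈ Set.Icc a b) :
    ∃ a' b', b' - a' = (1 - δ) * (b - a) ∧ ∀ i, P.mulVec x i ∈ Set.Icc a' b' := by
  -- Every row puts weight at least δ on x r, which pulls all averages off both endpoints.
  refine ⟨a + δ * (x r - a), b - δ * (b - x r), by ring, fun i => ?_⟩
  have hsum : ∑ j, P i j = 1 := by simpa [Matrix.mulVec, dotProduct] using congr_fun h1 i
  rw [Matrix.mulVec, dotProduct]
  constructor
  · have h : P i r * (x r - a) ≤ ∑ j, P i j * (x j - a) :=
      Finset.single_le_sum (f := fun j => P i j * (x j - a))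
        (fun j _ => mul_nonneg (hP i j) (sub_nonneg.2 (hx j).1)) (Finset.mem_univ r)
    simp only [mul_sub, Finset.sum_sub_distrib, ← Finset.sum_mul, hsum] at h
    have := mul_le_mul_of_nonneg_right (hδ i) (sub_nonneg.2 (hx r).1)
    linarith
  · have h : P i r * (b - x r) ≤ ∑ j, P i j * (b - x j) :=
      Finset.single_le_sum (f := fun j => P i j * (b - x j))
        (fun j _ => mul_nonneg (hP i j) (sub_nonneg.2 (hx j).2)) (Finset.mem_univ r)
    simp only [mul_sub, Finset.sum_sub_distrib, ← Finset.sum_mul, hsum] at h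
    have := mul_le_mul_of_nonneg_right (hδ i) (sub_nonneg.2 (hx r).2)
    linarith

/-- Real-valued consensus: if some node reaches all others, the solutions of `ẋ = -L x` on
`[0, ∞)` have vanishing differences at infinity. -/
theorem tendsto_sub_of_hasDerivWithinAt_consensusMatrix [DecidableEq V] {A : Matrix V V ℝ}
    (hA : ∀ i j, 0 ≤ A i j) {r : V}
    (hr : ∀ i, Relation.ReflTransGen (fun j i => 0 < A i j ∧ i ≠ j) r i) {x : ℝ → V → ℝ}
    (hx : ∀ t, 0 ≤ t → HasDerivWithinAt x ((consensusMatrix A).mulVec (x t)) (Set.Ici 0) t)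
    (i j : V) : Tendsto (fun t => x t i - x t j) atTop (𝓝 0) := by
  have : Nonempty V := ⟨r⟩
  set P := NormedSpace.exp (consensusMatrix A) with hPdef
  have hP : ∀ i j, 0 ≤ P i j := fun i j => by
    simpa using exp_smul_consensusMatrix_apply_nonneg hA zero_le_one i j
  have hP1 : P.mulVec 1 = 1 := by
    simpa using exp_smul_consensusMatrix_mulVec_one A zero_le_one
  obtain ⟨δ, hδ0, hδ1, hδ⟩ : ∃ δ, 0 < δ ∧ δ ≤ 1 ∧ ∀ i, δ ≤ P i r := by
    obtain ⟨k, hk⟩ := Finite.exists_min fun i => P i r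
    -- The cap at 1 keeps the ratio 1 - δ nonnegative.
    refine ⟨min 1 (P k r), lt_min one_pos (exp_consensusMatrix_apply_pos hA (hr k)),
      min_le_left _ _, fun i => (min_le_right _ _).trans (hk i)⟩
  obtain ⟨a₀, ha₀⟩ := Finite.exists_ge (x 0)
  obtain ⟨b₀, hb₀⟩ := Finite.exists_le (x 0)
  have key : ∀ k : ℕ, ∃ a b, b - a = (1 - δ) ^ k * (b₀ - a₀) ∧ ∀ i, x k i ∈ Set.Icc a b := by
    intro k
    induction k with
    | zero => exact ⟨a₀, b₀, by simp, fun i => by simpa using ⟨ha₀ i, hb₀ i⟩⟩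
    | succ k ih =>
      obtain ⟨a, b, hab, hk⟩ := ih
      obtain ⟨a', b', hab', h'⟩ := Matrix.exists_mulVec_mem_Icc hP hP1 hδ hk
      refine ⟨a', b', by rw [hab', hab]; ring, fun i => ?_⟩
      have := Matrix.eq_exp_mulVec_of_hasDerivWithinAt _ hx (s := k) (t := (k + 1 : ℕ))
        (by positivity) (by simp)
      rw [this]
      simpa using h' i
  have hlim : Tendsto (fun t : ℝ => (1 - δ) ^ ⌊t⌋₊ * (b₀ - a₀)) atTop (𝓝 0) := by
    have h := (tendsto_pow_atTop_nhds_zero_of_lt_one (sub_nonneg.2 hδ1)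
      (sub_lt_self 1 hδ0)).comp (tendsto_nat_floor_atTop (α := ℝ))
    simpa using h.mul_const (b₀ - a₀)
  refine squeeze_zero_norm' ?_ hlim
  filter_upwards [eventually_ge_atTop 0] with t ht
  obtain ⟨a, b, hab, hk⟩ := key ⌊t⌋₊
  have hfl := Nat.floor_le ht
  -- After the last integer time the flow is still stochastic, so it stays in the same interval.
  have ht' := Matrix.mulVec_mem_Icc
    (exp_smul_consensusMatrix_apply_nonneg hA (sub_nonneg.2 hfl))
    (exp_smul_consensusMatrix_mulVec_one A (sub_nonneg.2 hfl)) hk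
  rw [← Matrix.eq_exp_mulVec_of_hasDerivWithinAt _ hx (Nat.cast_nonneg _) hfl] at ht'
  rw [← hab, Real.norm_eq_abs, abs_sub_le_iff]
  constructor <;> linarith [(ht' i).1, (ht' i).2, (ht' j).1, (ht' j).2]

end Contraction

/-- Continuous linear maps between topological vector spaces preserve derivatives. -/
theorem HasDerivWithinAt.continuousLinearMap_comp {E F : Type*} [AddCommGroup E] [Module ℝ E]
    [TopologicalSpace E] [ContinuousSMul ℝ E] [AddCommGroup F] [Module ℝ F] [TopologicalSpace F]
    [ContinuousSMul ℝ F] (φ : E →L[ℝ] F) {f : ℝ → E} {f' : E} {s : Set ℝ} {t : ℝ}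
    (h : HasDerivWithinAt f f' s t) : HasDerivWithinAt (fun t => φ (f t)) (φ f') s t := by
  refine .of_isLittleOTVS <| ((φ.isBigOTVS_comp).trans_isLittleOTVS
    (HasFDerivAtFilter.isLittleOTVS h)).congr_left fun p => ?_
  simp

/-! ### Agents with dual quaternion outputs -/

namespace WeightedDigraph

variable {n : ℕ} (G : WeightedDigraph n)

theorem A_nonneg (i j : Fin n) : 0 ≤ G.A i j := by
  by_cases h : G.Adj j i
  · exact (G.pos_of_adj i j h).le
  · exact (G.eq_zero_of_not_adj i j h).ge

theorem achievesOutputConsensus {r : Fin n} (hr : ∀ v, Relation.ReflTransGen G.Adj r v)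
    {y u : Fin n → ℝ → PureDualQuaternion} (hy : IsSingleIntegrator y u)
    (hu : FollowsConsensusProtocol G y u) : AchievesOutputConsensus y := by
  have : FiniteDimensional ℝ DualQuaternion := inferInstanceAs (FiniteDimensional ℝ (ℍ[ℝ] × ℍ[ℝ]))
  -- The protocol has real coefficients, so each real coordinate solves the scalar system
  -- separately.
  let e : PureDualQuaternion ≃L[ℝ] (Fin (Module.finrank ℝ PureDualQuaternion) → ℝ) :=
    ContinuousLinearEquiv.ofFinrankEq (by simp)
  have hr' : ∀ i, Relation.ReflTransGen (fun j i => 0 < G.A i j ∧ i ≠ j) r i := fun i =>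
    Relation.ReflTransGen.mono
      (fun j i hji => ⟨G.pos_of_adj i j hji, by rintro rfl; exact G.loopless _ hji⟩) _ _ (hr i)
  intro i j
  have hcoord : ∀ k, Tendsto (fun t => e (y i t) k - e (y j t) k) atTop (𝓝 0) := fun k => by
    refine tendsto_sub_of_hasDerivWithinAt_consensusMatrix G.A_nonneg hr'
      (x := fun t i => e (y i t) k) (fun t ht => hasDerivWithinAt_pi.2 fun i => ?_) i j
    have h := hasDerivWithinAt_pi.1 ((hy i t ht).continuousLinearMap_comp e.toContinuousLinearMap) k
    refine h.congr_deriv ?_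
    rw [consensusMatrix_mulVec_apply, hu i t ht]
    simp
  have h := (e.symm.continuous.tendsto 0).comp
    (tendsto_pi_nhds (f := fun t => e (y i t - y j t)).2 fun k => by simpa using hcoord k)
  simpa [Function.comp_def] using h

theorem exists_not_achievesOutputConsensus [NeZero n]
    (hG : ¬ ∃ r, ∀ v, Relation.ReflTransGen G.Adj r v) :
    ∃ y u : Fin n → ℝ → PureDualQuaternion,
      IsSingleIntegrator y u ∧ FollowsConsensusProtocol G y u ∧ ¬ AchievesOutputConsensus y := by
  obtain ⟨a, b, hab⟩ := exists_no_common_ancestor hG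
  have hclosed : ∀ c, ∀ i ∈ {w | Relation.ReflTransGen G.Adj w c},
      ∀ j ∉ {w | Relation.ReflTransGen G.Adj w c}, G.A i j = 0 := fun c i hi j hj =>
    G.eq_zero_of_not_adj i j fun h => hj (Relation.ReflTransGen.head h hi)
  obtain ⟨x, ⟨i, j, hij⟩, hx⟩ := exists_nonconstant_mulVec_consensusMatrix_eq_zero
    (A := G.A) (S := {w | Relation.ReflTransGen G.Adj w a})
    (T := {w | Relation.ReflTransGen G.Adj w b}) (a := a) (b := b) (Relation.ReflTransGen.refl) (Relation.ReflTransGen.refl)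
    (Set.disjoint_left.2 hab) (hclosed a) (hclosed b)
  obtain ⟨q, hq⟩ : ∃ q : PureDualQuaternion, q ≠ 0 := by
    refine ⟨⟨TrivSqZeroExt.inl ⟨0, 1, 0, 0⟩, rfl⟩, fun h => ?_⟩
    have : (1 : ℝ) = 0 := congr_arg (fun p : PureDualQuaternion => p.1.fst.imI) h
    exact one_ne_zero this
  -- The nonconstant equilibrium, placed along a nonzero q, is a stationary solution.
  refine ⟨fun k _ => x k • q, fun _ _ => 0, fun k t _ => hasDerivWithinAt_const _ _ _,
    fun k t _ => ?_, fun h => ?_⟩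
  · have hk := congr_fun hx k
    rw [consensusMatrix_mulVec_apply] at hk
    have h : ∀ j, G.A k j • (x k • q - x j • q) = (G.A k j * (x k - x j)) • q := fun j => by
      rw [mul_smul, sub_smul]
    simp only [h, ← Finset.sum_smul, ← neg_smul]
    rw [hk, Pi.zero_apply, zero_smul]
  · have h0 := tendsto_nhds_unique (h i j) tendsto_const_nhds
    have h1 : (x i - x j) • q = 0 := (sub_smul (x i) (x j) q).trans h0.symm
    exact (smul_eq_zero.1 h1).elim (fun h => hij (sub_eq_zero.1 h)) hq

end WeightedDigraph

/-- The multi-agent system with dynamics `ẏ i = u i` under the protocol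
`u i = -∑ j, a i j (y i - y j)` achieves output consensus, whatever the initial outputs,
if and only if the network topology has a directed spanning tree. -/
theorem mainTheorem3 (n : ℕ) (hn : 1 ≤ n) (G : WeightedDigraph n) :
    (∀ y u : Fin n → ℝ → PureDualQuaternion,
      IsSingleIntegrator y u → FollowsConsensusProtocol G y u → AchievesOutputConsensus y) ↔
    HasDirectedSpanningTree G.toDigraph := by
  -- With no agents consensus is vacuous, but there is no root.
  have : NeZero n := ⟨by omega⟩
  rw [hasDirectedSpanningTree_iff_exists_forall_reflTransGen]
  constructor
  · intro h
    by_contra hG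
    obtain ⟨y, u, hy, hu, hyu⟩ := G.exists_not_achievesOutputConsensus hG
    exact hyu (h y u hy hu)
  · rintro ⟨r, hr⟩ y u hy hu
    exact G.achievesOutputConsensus hr hy hu
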